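/- All graphs are finite and simple. For a connected graph $G$, write $n(G)$ for its number of vertices and $d_G$ for its distance. A set $S\subseteq V(G)$ is resolving if for any two distinct vertices $x,y$ there is $s\in S$ with $d_G(x,s)\neq d_G(y,s)$, and the metric dimension $\dim(G)$ is the smallest cardinality of a resolving set of $G$. For graphs $G,H$ and a function $f\colon V(G)\to V(H)$, the Sierpiński product $G\otimes_f H$ is the graph on $V(G)\times V(H)$ whose edges are the pairs $(g,h)(g,h')$ with $g\in V(G)$ and $hh'\in E(H)$, and the pairs $(g,f(g'))(g',f(g))$ with $gg'\in E(G)$. The upper Sierpiński metric dimension is $$\operatorname{Dim}_{\rm S}(G,H)=\max\{\dim(G\otimes_f H) : f\colon V(G)\to V(H)\}.$$ **Theorem 2.3.** If $T_1$ and $T_2$ are trees with $n(T_2)\ge 3$, then $$\operatorname{Dim}_{\rm S}(T_1,T_2)=n(T_1)\dim(T_2).$$ Moreover, if $w$ is a branch vertex of $T_2$ (a vertex of degree at least $3$), then the maximum is attained by the constant function $f_w\equiv w$, that is, $\dim(T_1\otimes_{f_w}T_2)=n(T_1)\dim(T_2)$. -/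

import Mathlib

namespace SimpleGraph

/-- A set `S` of vertices of `G` is resolving if any two distinct vertices have different
vectors of distances to the members of `S`; that is, vertices whose distances to every
member of `S` agree are equal. -/
def IsResolvingSet {V : Type*} (G : SimpleGraph V) (S : Finset V) : Prop :=
  ∀ x y : V, (∀ s ∈ S, G.dist x s = G.dist y s) → x = y

/-- The metric dimension of `G`: the smallest cardinality of a resolving set. -/
noncomputable def metricDim {V : Type*} (G : SimpleGraph V) : ℕ :=
  sInf {k : ℕ | ∃ S : Finset V, G.IsResolvingSet S ∧ S.card = k}

/-- The Sierpiński product of `G` and `H` with respect to `f`: a copy of `H` for every vertex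
of `G`, and for every edge `g g'` of `G` the connecting edge `(g, f g') (g', f g)`. -/
def sierpinskiProduct {V W : Type*} (G : SimpleGraph V) (H : SimpleGraph W) (f : V → W) :
    SimpleGraph (V × W) where
  Adj x y := (x.1 = y.1 ∧ H.Adj x.2 y.2) ∨ (G.Adj x.1 y.1 ∧ x.2 = f y.1 ∧ y.2 = f x.1)
  symm := ⟨fun x y h => by
    rcases h with ⟨h1, h2⟩ | ⟨h1, h2, h3⟩
    · exact Or.inl ⟨h1.symm, h2.symm⟩
    · exact Or.inr ⟨h1.symm, h3, h2⟩⟩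
  loopless := ⟨fun x h => by
    rcases h with ⟨_, h2⟩ | ⟨h1, _, _⟩
    · exact H.loopless.irrefl _ h2
    · exact G.loopless.irrefl _ h1⟩

/-- The upper Sierpiński metric dimension of `G` and `H`: the maximum of the metric dimension
of the Sierpiński product over all functions `f`. -/
noncomputable def upperSierpinskiMetricDim {V W : Type*} (G : SimpleGraph V)
    (H : SimpleGraph W) : ℕ :=
  sSup (Set.range fun f : V → W => (G.sierpinskiProduct H f).metricDim)

/-- A branch vertex is a vertex of degree at least three. -/
def IsBranchVertex {V : Type*} (G : SimpleGraph V) (v : V) : Prop :=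
  3 ≤ (G.neighborSet v).ncard

/-- On a finite connected graph the infimum in the definition of the metric dimension is a minimum. -/
theorem metricDim_isLeast {V : Type*} [Fintype V] (G : SimpleGraph V) (hG : G.Connected) :
    IsLeast {k : ℕ | ∃ S : Finset V, G.IsResolvingSet S ∧ S.card = k} G.metricDim := by
  have hne : {k : ℕ | ∃ S : Finset V, G.IsResolvingSet S ∧ S.card = k}.Nonempty :=
    ⟨_, Finset.univ, fun x y h => by
      have h1 := h y (Finset.mem_univ y)
      rw [SimpleGraph.dist_self] at h1
      exact hG.dist_eq_zero_iff.mp h1, rfl⟩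
  exact ⟨Nat.sInf_mem hne, fun k hk => Nat.sInf_le hk⟩

/-- For finite graphs (with `H` nonempty) the supremum in the definition of the upper
Sierpiński metric dimension is a maximum. -/
theorem upperSierpinskiMetricDim_isGreatest {V W : Type*} [Finite V] [Finite W] [Nonempty W]
    (G : SimpleGraph V) (H : SimpleGraph W) :
    IsGreatest (Set.range fun f : V → W => (G.sierpinskiProduct H f).metricDim)
      (G.upperSierpinskiMetricDim H) := by
  have hfin : (Set.range fun f : V → W => (G.sierpinskiProduct H f).metricDim).Finite :=
    Set.finite_range _
  exact ⟨Nat.sSup_mem (Set.range_nonempty _) hfin.bddAbove,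
    fun k hk => le_csSup hfin.bddAbove hk⟩

end SimpleGraph

/-!
Everything rests on one observation. In a Sierpiński product `P = T₁ ⊗_f T₂` over a tree `T₁`,
the copy of `T₂` at `g` is *gated*: whatever lies over a vertex `v ≠ g` enters that copy through a
single vertex, which depends only on the branch of `T₁` at `g` that contains `v`. Hence copies
are isometric, and distances to a copy are distances to its gate plus distances in `T₂`
(`exists_sierpinskiProduct_gate`). Distances are bounded from below by means of functions that
change by at most one along edges (`Connected.sub_le_dist_of_adj`).

*Upper bound, for every `f`.* If `S` is resolving and nonempty in `T₂`, then all the copies of `S`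
together are resolving in `P` (`IsResolvingSet.univ_product`). Two vertices of one copy are
separated inside it. If `x`, `y` lie in different copies with gates `p`, `p'`, then agreement on
`S` in the copy of `x` forces `dist x p ≥ dist y p' + dist p p'`, and symmetrically, which is
absurd.

*Lower bound, for `f` constant equal to `w`.* Every gate is the copy of `w`, so if `R` is resolving
in `P`, each slice of `R` becomes resolving in `T₂` after `w` is added to it
(`IsResolvingSet.insert_slice`). If `w` is a branch vertex, then a set `S` for which
`insert w S` is resolving meets at least two of the branches at `w`, and so determines the
distance to `w`: thus `S` itself is resolving (`IsResolvingSet.of_insert_of_isBranchVertex`).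
If `T₂` has no branch vertex, a leaf is a resolving set, so `T₂` has metric dimension one; any
vertex `w` with two neighbours then serves, because `{w}` is not resolving and no slice can
be empty.
-/

namespace SimpleGraph

variable {V W : Type*}

/-! ### Branches of a tree at a vertex -/

/-- A function changing by at most one along edges is bounded by the distance. -/
theorem Connected.sub_le_dist_of_adj {G : SimpleGraph V} (hG : G.Connected) (φ : V → ℤ)
    (hφ : ∀ x y, G.Adj x y → φ x ≤ φ y + 1) (x y : V) : φ x - φ y ≤ G.dist x y := by
  obtain ⟨p, hp⟩ := hG.exists_walk_length_eq_dist x y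
  rw [← hp]
  clear hp
  induction p with
  | nil => simp
  | cons h p ih =>
    have := hφ _ _ h
    rw [Walk.length_cons]
    push_cast
    linarith

/-- The distance to a fixed vertex changes by at most one along an edge. -/
theorem Connected.dist_le_dist_add_one {G : SimpleGraph V} (hG : G.Connected) {x y : V}
    (h : G.Adj x y) (z : V) : G.dist x z ≤ G.dist y z + 1 := by
  have := hG.dist_triangle (u := x) (v := y) (w := z)
  rw [dist_eq_one_iff_adj.mpr h] at this
  omega

/-- The branches of a tree at `g`, encoded by a function `q` sending a vertex `v ≠ g` to the
neighbour of `g` in the branch of `v`. -/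
theorem IsTree.exists_branch {G : SimpleGraph V} (hG : G.IsTree) (g : V) :
    ∃ q : V → V, (∀ u, G.Adj g u → q u = u) ∧
      ∀ u v, u ≠ g → v ≠ g → G.Adj u v → q u = q v := by
  classical
  -- `K` is `G` with the edges at `g` removed: its components other than `{g}` are the branches.
  let K : SimpleGraph V :=
    { Adj := fun u v => G.Adj u v ∧ u ≠ g ∧ v ≠ g
      symm := ⟨fun u v h => ⟨h.1.symm, h.2.2, h.2.1⟩⟩
      loopless := ⟨fun u h => G.loopless.irrefl _ h.1⟩ }
  have hex : ∀ v, v ≠ g → ∃ a, G.Adj g a ∧ K.Reachable a v := by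
    have key : ∀ u v (p : G.Walk u v), v ≠ g →
        (u ≠ g → K.Reachable u v ∨ ∃ a, G.Adj g a ∧ K.Reachable a v) ∧
        (u = g → ∃ a, G.Adj g a ∧ K.Reachable a v) := by
      intro u v p hv
      induction p with
      | nil => exact ⟨fun _ => Or.inl (Reachable.refl _), fun h => absurd h hv⟩
      | @cons a b c h p ih =>
        obtain ⟨ih1, ih2⟩ := ih hv
        by_cases hb : b = g
        · exact ⟨fun _ => Or.inr (ih2 hb), fun _ => ih2 hb⟩
        · refine ⟨fun ha => ?_, fun ha => ?_⟩
          · rcases ih1 hb with h1 | h1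
            · exact Or.inl ((Adj.reachable (show K.Adj a b from ⟨h, ha, hb⟩)).trans h1)
            · exact Or.inr h1
          · rcases ih1 hb with h1 | h1
            · exact ⟨b, ha ▸ h, h1⟩
            · exact h1
    intro v hv
    obtain ⟨p⟩ := hG.connected.preconnected g v
    exact (key g v p hv).2 rfl
  have huniq : ∀ a b, G.Adj g a → G.Adj g b → K.Reachable a b → a = b := by
    intro a b ha hb hab
    by_contra hne
    -- Otherwise the edge `g a` would not be a bridge: `b` is joined to `a` away from `g`.
    have hbr := isAcyclic_iff_forall_adj_isBridge.mp hG.isAcyclic ha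
    rw [isBridge_iff] at hbr
    refine hbr ?_
    have hle : K ≤ G \ fromEdgeSet {s(g, a)} := by
      intro u v h
      simp only [sdiff_adj, fromEdgeSet_adj, Set.mem_singleton_iff, Sym2.eq_iff]
      refine ⟨h.1, ?_⟩
      have := h.2.1
      have := h.2.2
      tauto
    have hgb : (G \ fromEdgeSet {s(g, a)}).Adj g b := by
      simp only [sdiff_adj, fromEdgeSet_adj, Set.mem_singleton_iff, Sym2.eq_iff]
      refine ⟨hb, ?_⟩
      rintro ⟨⟨-, h⟩ | ⟨h, -⟩, -⟩
      · exact hne h.symm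
      · exact ha.ne h
    exact hgb.reachable.trans (hab.mono hle).symm
  choose! q hq1 hq2 using hex
  refine ⟨q, fun u hu => ?_, fun u v hu hv huv => ?_⟩
  · exact huniq _ _ (hq1 u hu.ne') hu (hq2 u hu.ne')
  · refine huniq _ _ (hq1 u hu) (hq1 v hv) ?_
    exact ((hq2 u hu).trans (Adj.reachable (show K.Adj u v from ⟨huv, hu, hv⟩))).trans
      (hq2 v hv).symm

/-- Geodesics between different branches at `w` pass through `w`. -/
theorem Connected.dist_eq_add_of_branch_ne {G : SimpleGraph V} (hG : G.Connected) {w : V}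
    {q : V → V} (hq : ∀ u v, u ≠ w → v ≠ w → G.Adj u v → q u = q v) {x s : V}
    (hxs : q x ≠ q s) : G.dist x s = G.dist x w + G.dist w s := by
  classical
  refine le_antisymm hG.dist_triangle ?_
  -- Apply the bound to the distance to `w`, taken with a negative sign on the branch of `s`.
  have := hG.sub_le_dist_of_adj
    (fun z => if q z = q s then - (G.dist z w : ℤ) else G.dist z w) (fun u v huv => ?_) x s
  · simp only [hxs, if_false, if_true] at this
    rw [dist_comm (u := w)]
    omega
  · have h1 := hG.dist_le_dist_add_one huv w
    have h2 := hG.dist_le_dist_add_one huv.symm w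
    by_cases hu : u = w
    · subst hu
      rw [dist_self] at *
      split_ifs <;> omega
    · by_cases hv : v = w
      · subst hv
        rw [dist_self] at *
        split_ifs <;> omega
      · simp only [hq u v hu hv huv]
        split_ifs <;> omega

/-! ### Distances in a Sierpiński product -/

theorem dist_sierpinskiProduct_le (G : SimpleGraph V) {H : SimpleGraph W} (hH : H.Connected)
    (f : V → W) (g : V) (h s : W) :
    (G.sierpinskiProduct H f).dist (g, h) (g, s) ≤ H.dist h s := by
  obtain ⟨p, hp⟩ := hH.exists_walk_length_eq_dist h s
  let F : H →g G.sierpinskiProduct H f := ⟨fun a => (g, a), fun hab => Or.inl ⟨rfl, hab⟩⟩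
  rw [← hp, ← Walk.length_map F p]
  exact dist_le _

theorem Connected.sierpinskiProduct {G : SimpleGraph V} {H : SimpleGraph W} (hG : G.Connected)
    (hH : H.Connected) (f : V → W) : (G.sierpinskiProduct H f).Connected := by
  have hcopy : ∀ g h s, (G.sierpinskiProduct H f).Reachable (g, h) (g, s) := by
    intro g h s
    let F : H →g G.sierpinskiProduct H f := ⟨fun a => (g, a), fun hab => Or.inl ⟨rfl, hab⟩⟩
    exact (hH.preconnected h s).map F
  have key : ∀ u v (_ : G.Walk u v) (h s : W),
      (G.sierpinskiProduct H f).Reachable (u, h) (v, s) := by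
    intro u v p
    induction p with
    | nil => exact hcopy _
    | @cons a b c hab p ih =>
      intro h s
      have hadj : (G.sierpinskiProduct H f).Adj (a, f b) (b, f a) := Or.inr ⟨hab, rfl, rfl⟩
      exact ((hcopy a h (f b)).trans hadj.reachable).trans (ih _ _)
  have := hG.nonempty
  have := hH.nonempty
  refine ⟨fun x y => ?_⟩
  obtain ⟨p⟩ := hG.preconnected x.1 y.1
  exact key _ _ p x.2 y.2

/-- Copies of `H` are isometric and gated: all that lies over a vertex `v` other than `g`
enters the copy at `g` through `f (q v)`, where `q v` is the neighbour of `g` towards `v`. -/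
theorem exists_sierpinskiProduct_gate {G : SimpleGraph V} {H : SimpleGraph W} (hG : G.IsTree)
    (hH : H.Connected) (f : V → W) (g : V) :
    (∀ h s, (G.sierpinskiProduct H f).dist (g, h) (g, s) = H.dist h s) ∧
    ∃ q : V → V, ∀ v, v ≠ g → ∀ h s, (G.sierpinskiProduct H f).dist (v, h) (g, s) =
      (G.sierpinskiProduct H f).dist (v, h) (g, f (q v)) + H.dist (f (q v)) s := by
  classical
  set P := G.sierpinskiProduct H f
  have hPc : P.Connected := hG.connected.sierpinskiProduct hH f
  obtain ⟨q, hq1, hq2⟩ := hG.exists_branch g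
  -- `ρ` sends a vertex to its gate in the copy at `g`.
  let ρ : V × W → W := fun z => if z.1 = g then z.2 else f (q z.1)
  have hρ : ∀ x y, P.Adj x y →
      ρ x = ρ y ∨ (x = (g, ρ x) ∧ y = (g, ρ y) ∧ H.Adj (ρ x) (ρ y)) := by
    rintro ⟨a, b⟩ ⟨c, d⟩ (⟨h1, h2⟩ | ⟨h1, h2, h3⟩)
    · simp only at h1 h2
      subst h1
      by_cases ha : a = g
      · right
        simp only [ρ, ha, if_true]
        exact ⟨trivial, trivial, h2⟩
      · left
        simp [ρ, ha]
    · simp only at h1 h2 h3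
      left
      by_cases ha : a = g
      · subst ha
        simp [ρ, h1.ne', h2, hq1 c h1]
      · by_cases hc : c = g
        · subst hc
          simp [ρ, ha, h3, hq1 a h1.symm]
        · simp [ρ, ha, hc, hq2 a c ha hc h1]
  have low : ∀ x s, P.dist x (g, ρ x) + H.dist (ρ x) s ≤ P.dist x (g, s) := by
    intro x s
    have := hPc.sub_le_dist_of_adj
      (fun z => (P.dist z (g, ρ z) : ℤ) + H.dist (ρ z) s) (fun u v huv => ?_) x (g, s)
    · simp only [ρ, if_true, dist_self] at this ⊢
      push_cast at this
      omega
    · rcases hρ u v huv with h | ⟨h1, h2, h3⟩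
      · simp only [h]
        have := hPc.dist_le_dist_add_one huv (g, ρ v)
        omega
      · have := hH.dist_le_dist_add_one h3 s
        simp only [← h1, ← h2, dist_self]
        omega
  refine ⟨fun h s => ?_, q, fun v hv h s => ?_⟩
  · refine le_antisymm (dist_sierpinskiProduct_le G hH f g h s) ?_
    have := low (g, h) s
    simp only [ρ, if_true] at this
    omega
  · have h1 := low (v, h) s
    simp only [ρ, hv, if_false] at h1
    have h2 := hPc.dist_triangle (u := (v, h)) (v := (g, f (q v))) (w := (g, s))
    have h3 : P.dist (g, f (q v)) (g, s) ≤ _ :=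
      dist_sierpinskiProduct_le G hH f g (f (q v)) s
    omega

/-! ### The upper bound -/

/-- The copies of a nonempty resolving set form a resolving set of the product. -/
theorem IsResolvingSet.univ_product [Fintype V] {G : SimpleGraph V} {H : SimpleGraph W}
    (hG : G.IsTree) (hH : H.Connected) {S : Finset W} (hS : H.IsResolvingSet S)
    (hne : S.Nonempty) (f : V → W) :
    (G.sierpinskiProduct H f).IsResolvingSet (Finset.univ ×ˢ S) := by
  rintro ⟨a, b⟩ ⟨c, d⟩ hxy
  have hPc : (G.sierpinskiProduct H f).Connected := hG.connected.sierpinskiProduct hH f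
  obtain ⟨ha, q, hq⟩ := exists_sierpinskiProduct_gate hG hH f a
  by_cases hac : c = a
  · subst hac
    congr 1
    refine hS _ _ fun s hs => ?_
    have := hxy (c, s) (by simp [hs])
    rwa [ha, ha] at this
  · exfalso
    obtain ⟨hc, r, hr⟩ := exists_sierpinskiProduct_gate hG hH f c
    obtain ⟨s, hs⟩ := hne
    have e1 := hxy (a, s) (by simp [hs])
    have e2 := hxy (c, s) (by simp [hs])
    rw [ha, hq c hac] at e1
    rw [hc, hr a (Ne.symm hac)] at e2
    have t1 := hH.dist_triangle (u := b) (v := f (q c)) (w := s)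
    have t2 := hH.dist_triangle (u := d) (v := f (r a)) (w := s)
    -- Each of the distances `dist y p` and `dist x p'` splits further at the other gate.
    have k1 := hr a (Ne.symm hac) (f (q c)) d
    have k2 := hq c hac (f (r a)) b
    have k3 := hPc.pos_dist_of_ne
      (show (a, f (q c)) ≠ (c, f (r a)) from fun h => hac (congrArg Prod.fst h).symm)
    rw [dist_comm] at k1
    rw [dist_comm] at k2
    rw [dist_comm (u := (c, f (r a)))] at k2
    rw [dist_comm (u := f (r a))] at k1
    rw [dist_comm (u := f (q c))] at k2
    omega

theorem metricDim_sierpinskiProduct_le [Fintype V] [Fintype W] [Nontrivial W]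
    {G : SimpleGraph V} {H : SimpleGraph W} (hG : G.IsTree) (hH : H.Connected) (f : V → W) :
    (G.sierpinskiProduct H f).metricDim ≤ Fintype.card V * H.metricDim := by
  obtain ⟨S, hS, hcard⟩ := (metricDim_isLeast H hH).1
  have hne : S.Nonempty := by
    rw [Finset.nonempty_iff_ne_empty]
    rintro rfl
    obtain ⟨x, y, hxy⟩ := exists_pair_ne W
    exact hxy (hS x y (by simp))
  refine Nat.sInf_le ⟨_, hS.univ_product hG hH hne f, ?_⟩
  rw [Finset.card_product, hcard, Finset.card_univ]

/-! ### The lower bound for constant functions -/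

/-- The part of `R` in the copy of `W` over `g`. -/
noncomputable def slice (R : Finset (V × W)) (g : V) : Finset W :=
  R.preimage (Prod.mk g) (Prod.mk_right_injective g).injOn

theorem mem_slice {R : Finset (V × W)} {g : V} {s : W} : s ∈ slice R g ↔ (g, s) ∈ R :=
  Finset.mem_preimage

theorem sum_card_slice [Fintype V] (R : Finset (V × W)) : ∑ g, (slice R g).card = R.card := by
  classical
  rw [Finset.card_eq_sum_card_fiberwise (f := Prod.fst) (t := Finset.univ) (by simp)]
  refine Finset.sum_congr rfl fun g _ => ?_
  rw [← Finset.card_image_of_injective (slice R g) (Prod.mk_right_injective g)]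
  congr 1
  ext ⟨a, b⟩
  simp only [Finset.mem_image, mem_slice, Prod.mk.injEq, Finset.mem_filter]
  constructor
  · rintro ⟨s, hs, rfl, rfl⟩
    exact ⟨hs, rfl⟩
  · rintro ⟨h, rfl⟩
    exact ⟨b, h, rfl, rfl⟩

theorem IsResolvingSet.insert_slice [DecidableEq W] {G : SimpleGraph V} {H : SimpleGraph W}
    (hG : G.IsTree) (hH : H.Connected) {w : W} {R : Finset (V × W)}
    (hR : (G.sierpinskiProduct H fun _ => w).IsResolvingSet R) (g : V) :
    H.IsResolvingSet (insert w (slice R g)) := by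
  intro x y hxy
  obtain ⟨hg, q, hq⟩ := exists_sierpinskiProduct_gate hG hH (fun _ => w) g
  suffices h : ((g, x) : V × W) = (g, y) from congrArg Prod.snd h
  refine hR _ _ ?_
  rintro ⟨v, s⟩ hs
  by_cases hv : v = g
  · subst hv
    rw [hg, hg]
    exact hxy s (Finset.mem_insert_of_mem (mem_slice.mpr hs))
  · have hw := hxy w (Finset.mem_insert_self _ _)
    rw [dist_comm (u := (g, x)), dist_comm (u := (g, y)), hq v hv s x, hq v hv s y,
      dist_comm (v := x), hw, dist_comm (u := y)]

theorem card_mul_le_metricDim_sierpinskiProduct [Fintype V] [Fintype W] [DecidableEq W]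
    {G : SimpleGraph V} {H : SimpleGraph W} (hG : G.IsTree) (hH : H.Connected) {w : W}
    (hw : ∀ S : Finset W, H.IsResolvingSet (insert w S) → H.metricDim ≤ S.card) :
    Fintype.card V * H.metricDim ≤ (G.sierpinskiProduct H fun _ => w).metricDim := by
  obtain ⟨R, hR, hcard⟩ := (metricDim_isLeast _ (hG.connected.sierpinskiProduct hH fun _ => w)).1
  rw [← hcard, ← sum_card_slice, ← smul_eq_mul, ← Finset.card_univ]
  exact Finset.card_nsmul_le_sum _ _ _ fun g _ => hw _ (hR.insert_slice hG hH g)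

/-- A branch vertex may be dropped from a resolving set of a tree: the remaining vertices
lie in two branches at `w` or more, and distances to two such vertices determine that to `w`. -/
theorem IsResolvingSet.of_insert_of_isBranchVertex [DecidableEq W] {H : SimpleGraph W}
    (hH : H.IsTree) {w : W} (hw : H.IsBranchVertex w) {S : Finset W}
    (hS : H.IsResolvingSet (insert w S)) : H.IsResolvingSet S := by
  obtain ⟨q, hq1, hq2⟩ := hH.exists_branch w
  have hc := hH.connected
  have hcut : ∀ {x s}, q x ≠ q s → H.dist x s = H.dist x w + H.dist w s :=
    fun h => hc.dist_eq_add_of_branch_ne hq2 h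
  -- Two branches cannot both be missed by `S`: their vertices next to `w` would agree.
  have hpair : ∀ a b, H.Adj w a → H.Adj w b → a ≠ b → ∃ s ∈ S, q s = a ∨ q s = b := by
    intro a b ha hb hab
    by_contra! hcon
    refine hab (hS a b fun s hs => ?_)
    have da := dist_eq_one_iff_adj.mpr ha.symm
    have db := dist_eq_one_iff_adj.mpr hb.symm
    rcases Finset.mem_insert.mp hs with rfl | hs
    · rw [da, db]
    · obtain ⟨h1, h2⟩ := hcon s hs
      have ea : q a ≠ q s := by rw [hq1 a ha]; exact h1.symm
      have eb : q b ≠ q s := by rw [hq1 b hb]; exact h2.symm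
      rw [hcut ea, hcut eb, da, db]
  have htwo : ∃ s₁ ∈ S, ∃ s₂ ∈ S, q s₁ ≠ q s₂ := by
    obtain ⟨t, htsub, ht⟩ := Set.exists_subset_card_eq hw
    obtain ⟨a, b, c, hab, hac, hbc, rfl⟩ := Set.ncard_eq_three.mp ht
    have ha : H.Adj w a := htsub (by simp)
    have hb : H.Adj w b := htsub (by simp)
    have hd : H.Adj w c := htsub (by simp)
    obtain ⟨s, hs, h1⟩ := hpair a b ha hb hab
    rcases h1 with h1 | h1
    · obtain ⟨t, ht, h2⟩ := hpair b c hb hd hbc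
      exact ⟨s, hs, t, ht, by rcases h2 with h2 | h2 <;> rw [h1, h2] <;> assumption⟩
    · obtain ⟨t, ht, h2⟩ := hpair a c ha hd hac
      exact ⟨s, hs, t, ht, by
        rcases h2 with h2 | h2 <;> rw [h1, h2]
        · exact hab.symm
        · assumption⟩
  obtain ⟨s₁, hs₁, s₂, hs₂, hne⟩ := htwo
  have hle : ∀ x y, (∀ s ∈ S, H.dist x s = H.dist y s) → H.dist x w ≤ H.dist y w := by
    intro x y h
    have aux : ∀ s ∈ S, q x ≠ q s → H.dist x w ≤ H.dist y w := by
      intro s hs hx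
      have := hcut hx
      have := h s hs
      have := hc.dist_triangle (u := y) (v := w) (w := s)
      omega
    by_cases hx : q x = q s₁
    · exact aux s₂ hs₂ (hx ▸ hne)
    · exact aux s₁ hs₁ hx
  intro x y hxy
  refine hS x y fun s hs => ?_
  rcases Finset.mem_insert.mp hs with rfl | hs
  · exact le_antisymm (hle x y hxy) (hle y x fun s hs => (hxy s hs).symm)
  · exact hxy s hs

/-! ### Trees without branch vertices -/

theorem Connected.exists_adj_dist_add_one {G : SimpleGraph V} (hG : G.Connected) {x l : V}
    (h : x ≠ l) : ∃ y, G.Adj x y ∧ G.dist y l + 1 = G.dist x l := by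
  obtain ⟨p, hp⟩ := hG.exists_walk_length_eq_dist x l
  cases p with
  | nil => exact absurd rfl h
  | @cons _ y _ hxy p =>
    refine ⟨y, hxy, ?_⟩
    have h1 := hG.dist_le_dist_add_one hxy l
    have h2 := dist_le p
    rw [Walk.length_cons] at hp
    omega

/-- If no vertex is a branch vertex, then a leaf is a resolving set: where two geodesics from the
leaf part there would be a branch vertex. -/
theorem Connected.isResolvingSet_leaf [Finite V] {G : SimpleGraph V} (hG : G.Connected)
    (hb : ∀ v, ¬ G.IsBranchVertex v) {l : V} (hl : (G.neighborSet l).ncard ≤ 1) :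
    G.IsResolvingSet {l} := by
  have key : ∀ n x y, G.dist x l = n → G.dist y l = n → x = y := by
    intro n
    induction n with
    | zero =>
      intro x y hx hy
      rw [hG.dist_eq_zero_iff] at hx hy
      rw [hx, hy]
    | succ n ih =>
      intro x y hx hy
      have hxl : x ≠ l := by rintro rfl; simp at hx
      have hyl : y ≠ l := by rintro rfl; simp at hy
      obtain ⟨x', hx1, hx2⟩ := hG.exists_adj_dist_add_one hxl
      obtain ⟨y', hy1, hy2⟩ := hG.exists_adj_dist_add_one hyl
      have : y' = x' := ih _ _ (by omega) (by omega)
      subst this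
      by_contra hne
      by_cases hz : y' = l
      · subst hz
        exact hne ((Set.ncard_le_one (Set.toFinite _)).mp hl x hx1.symm y hy1.symm)
      · obtain ⟨z, hz1, hz2⟩ := hG.exists_adj_dist_add_one hz
        refine hb y' ?_
        have hsub : ({x, y, z} : Set V) ⊆ G.neighborSet y' := by
          rintro a (rfl | rfl | rfl)
          exacts [hx1.symm, hy1.symm, hz1]
        have hxz : x ≠ z := by rintro rfl; omega
        have hyz : y ≠ z := by rintro rfl; omega
        rw [IsBranchVertex, ← Set.ncard_eq_three.mpr ⟨x, y, z, hne, hxz, hyz, rfl⟩]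
        exact Set.ncard_le_ncard hsub (Set.toFinite _)
  intro x y h
  exact key _ x y rfl (h l (Finset.mem_singleton_self l)).symm

theorem Connected.exists_two_neighbors [Fintype V] {G : SimpleGraph V} (hG : G.Connected)
    (hn : 3 ≤ Fintype.card V) : ∃ w a b, G.Adj w a ∧ G.Adj w b ∧ a ≠ b := by
  classical
  by_contra! hcon
  have : Nontrivial V := Fintype.one_lt_card_iff_nontrivial.mp (by omega)
  obtain ⟨x⟩ := hG.nonempty
  obtain ⟨y, hy⟩ := exists_ne x
  obtain ⟨z, hxz, -⟩ := hG.exists_adj_dist_add_one hy.symm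
  -- The edge `x z` is a component, so every vertex is one of its ends.
  have hall : ∀ u v (_ : G.Walk u v), u = x ∨ u = z → v = x ∨ v = z := by
    intro u v p
    induction p with
    | nil => exact id
    | @cons a b c hab p ih =>
      rintro (rfl | rfl)
      · exact ih (Or.inr (hcon _ _ _ hab hxz))
      · exact ih (Or.inl (hcon _ _ _ hab hxz.symm))
  have hle : (Finset.univ : Finset V) ⊆ {x, z} := by
    intro v _
    obtain ⟨p⟩ := hG.preconnected x v
    simpa using hall x v p (Or.inl rfl)
  have := Finset.card_le_card hle
  have := Finset.card_le_two (a := x) (b := z)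
  rw [Finset.card_univ] at *
  omega

/-- In a tree with at least three vertices, some vertex `w` is not worth including for free: a set
that becomes resolving once `w` is added to it has as many elements as a resolving set. -/
theorem IsTree.exists_metricDim_le_card [Fintype W] [DecidableEq W] {H : SimpleGraph W}
    (hH : H.IsTree) (hn : 3 ≤ Fintype.card W) :
    ∃ w, ∀ S : Finset W, H.IsResolvingSet (insert w S) → H.metricDim ≤ S.card := by
  classical
  by_cases hb : ∃ w, H.IsBranchVertex w
  · obtain ⟨w, hw⟩ := hb
    exact ⟨w, fun S hS => Nat.sInf_le ⟨S, hS.of_insert_of_isBranchVertex hH hw, rfl⟩⟩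
  · push Not at hb
    obtain ⟨w, a, b, ha, hb', hab⟩ := hH.connected.exists_two_neighbors hn
    refine ⟨w, fun S hS => ?_⟩
    have : Nontrivial W := Fintype.one_lt_card_iff_nontrivial.mp (by omega)
    obtain ⟨l, hl⟩ := hH.exists_vert_degree_one_of_nontrivial
    have hl' : (H.neighborSet l).ncard ≤ 1 := by
      rw [← Nat.card_coe_set_eq, Nat.card_eq_fintype_card, card_neighborSet_eq_degree, hl]
    have h1 : H.metricDim ≤ 1 :=
      Nat.sInf_le ⟨{l}, hH.connected.isResolvingSet_leaf hb hl', by simp⟩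
    refine h1.trans (Finset.card_pos.mpr (Finset.nonempty_iff_ne_empty.mpr ?_))
    rintro rfl
    refine hab (hS a b fun s hs => ?_)
    have hs : s = w := by simpa using hs
    rw [hs, dist_eq_one_iff_adj.mpr ha.symm, dist_eq_one_iff_adj.mpr hb'.symm]

end SimpleGraph

open SimpleGraph in
theorem theorem2p3 {V W : Type*} [Fintype V] [Fintype W]
    (T₁ : SimpleGraph V) (T₂ : SimpleGraph W) (hT₁ : T₁.IsTree) (hT₂ : T₂.IsTree)
    (hn : 3 ≤ Fintype.card W) :
    T₁.upperSierpinskiMetricDim T₂ = Fintype.card V * T₂.metricDim ∧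
      ∀ w : W, T₂.IsBranchVertex w →
        (T₁.sierpinskiProduct T₂ (fun _ => w)).metricDim = Fintype.card V * T₂.metricDim := by
  classical
  have hH := hT₂.connected
  have : Nontrivial W := Fintype.one_lt_card_iff_nontrivial.mp (by omega)
  have hle := metricDim_sierpinskiProduct_le hT₁ hH
  have hmax := upperSierpinskiMetricDim_isGreatest T₁ T₂
  refine ⟨le_antisymm ?_ ?_, fun w hw => le_antisymm (hle _) ?_⟩
  · obtain ⟨f, hf⟩ := hmax.1
    rw [← hf]
    exact hle f
  · obtain ⟨w, hw⟩ := hT₂.exists_metricDim_le_card hn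
    exact (card_mul_le_metricDim_sierpinskiProduct hT₁ hH hw).trans (hmax.2 ⟨_, rfl⟩)
  · exact card_mul_le_metricDim_sierpinskiProduct hT₁ hH fun S hS =>
      Nat.sInf_le ⟨S, hS.of_insert_of_isBranchVertex hT₂ hw, rfl⟩
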